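/- Let $n\in\mathbb N$ be finite, let $\mathcal H$ be a separable complex Hilbert space, and let $V\in\mathscr V_n(\mathcal H)$: $V$ is a bounded operator on $\mathcal H$ that is a partial isometry, $\dim\ker V=\dim(\operatorname{Ran}V)^\perp=n$, and $V$ is completely non-unitary (no nonzero closed reducing subspace $\mathcal M$ of $V$ is such that $V|_{\mathcal M}$ is unitary on $\mathcal M$). Let $\mathbb D$ be the open unit disk and $\mathbb T$ the unit circle. Let $b=w_V:\mathbb D\to M_n(\mathbb C)$ be the Livšic characteristic function of $V$, that is, for some orthonormal basis $\mathbf v_1,\dots,\mathbf v_n$ of $\ker V$ and some unitary $U$ on $\mathcal H$ that agrees with $V$ on $(\ker V)^\perp$, $$b(z)=z\,\big[\langle (U-zI)^{-1}\mathbf v_j,\mathbf v_k\rangle\big]\,\big[\langle (U-zI)^{-1}U\mathbf v_j,\mathbf v_k\rangle\big]^{-1},\qquad z\in\mathbb D,$$ where $k$ is the row index and $j$ the column index. Let $\Gamma$ be an abstract model for $V$: an anti-analytic function $\Gamma:\mathbb C\setminus\mathbb T\to\mathcal B(\mathbb C^n,\mathcal H)$ such that, for each $z\in\mathbb C\setminus\mathbb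 T$, $\Gamma(z)$ is a linear bijection of $\mathbb C^n$ onto $\big((V-zI)(\ker V)^\perp\big)^\perp$. For $f\in\mathcal H$ put $\widehat f(z)=\Gamma(z)^*f$, $z\in\mathbb C\setminus\mathbb T$. Then $f\mapsto\widehat f$ is injective, so that $\mathscr H_{V,\Gamma}=\{\widehat f:f\in\mathcal H\}$ with $\langle\widehat f,\widehat g\rangle=\langle f,g\rangle$ is a Hilbert space of functions (the abstract model space of $V$ induced by $\Gamma$). Let $G_b=(I+b)(I-b)^{-1}$ on $\mathbb D$ and $G_b(z)=-G_b(1/\overline z)^*$ for $|z|>1$. Then $$K_w(z)=\frac{G_b(z)+G_b(w)^*}{1-z\overline w},\qquad z,w\in\mathbb C\setminus\mathbb T$$ (with the removable-singularity value $-zG_b'(z)$ when $z\overline w=1$), is a positive semidefinite $M_n(\mathbb C)$-valued kernel; let the Herglotz space $\mathscr L(b)$ be the Hilbert space of $\mathbb C^n$-valued functions on $\mathbb C\setminus\mathbb T$ with reproducing kernel $K$. Then there is an analytic $W:\mathbb C\setminus\mathbb T\to M_n(\mathbb C)$ such that $W\mathscr H_{V,\Gamma}=\mathscr L(b)$ and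 $$\|Wf\|_{\mathscr L(b)}=\|f\|_{\mathscr H_{V,\Gamma}},\qquad f\in\mathscr H_{V,\Gamma}.$$ Moreover $\widetilde\Gamma(z)=\Gamma(z)W(z)^*$ is again an abstract model for $V$, and $\mathscr H_{V,\widetilde\Gamma}=\mathscr L(b)$ with equality of norms. -/

import Mathlib

noncomputable section

namespace HerglotzModel

open scoped InnerProductSpace ComplexConjugate Matrix

/-- `ℂⁿ` with its standard inner product. -/
abbrev Cn (n : ℕ) : Type := EuclideanSpace ℂ (Fin n)

/-- The set `ℂ ∖ 𝕋`. -/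
def offCircle : Set ℂ := {z | ‖z‖ ≠ 1}

section Operators

variable {H : Type*} [NormedAddCommGroup H] [InnerProductSpace ℂ H] [CompleteSpace H]

/-- `V` is a partial isometry: it is isometric on the orthogonal complement of its kernel. -/
def IsPartialIsometry (V : H →L[ℂ] H) : Prop :=
  ∀ x ∈ (V.ker)ᗮ, ‖V x‖ = ‖x‖

/-- `V` is completely non-unitary: the only (closed) reducing subspace `M` on which `V` restricts
to a unitary operator (an isometry of `M` onto `M`) is `M = 0`. -/
def IsCompletelyNonUnitary (V : H →L[ℂ] H) : Prop :=
  ∀ M : Submodule ℂ H, IsClosed (M : Set H) →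
    (∀ x ∈ M, V x ∈ M) → (∀ x ∈ M, ContinuousLinearMap.adjoint V x ∈ M) →
    (∀ x ∈ M, ‖V x‖ = ‖x‖) → (∀ y ∈ M, ∃ x ∈ M, V x = y) → M = ⊥

/-- The class `𝒱_n(H)`: completely non-unitary partial isometries both of whose defect spaces
`ker V` and `(ran V)ᗮ` have dimension `n`. -/
structure IsClassV (n : ℕ) (V : H →L[ℂ] H) : Prop where
  partialIsometry : IsPartialIsometry V
  rank_ker : Module.rank ℂ V.ker = n
  rank_range_orthogonal : Module.rank ℂ (V.range)ᗮ = n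
  completelyNonUnitary : IsCompletelyNonUnitary V

/-- `U` is a unitary operator on `H` that agrees with `V` on the initial space of `V`. -/
def IsUnitaryExtension (V U : H →L[ℂ] H) : Prop :=
  U ∈ unitary (H →L[ℂ] H) ∧ ∀ x ∈ (V.ker)ᗮ, U x = V x

/-- The `n × n` matrix of the compression to `ker V` of an operator `T`, with respect to an
orthonormal basis `v` of `ker V`: the entry in row `k` and column `j` is `⟨T vⱼ, vₖ⟩`
(linear in `T vⱼ`). -/
def compressionMatrix {n : ℕ} {V : H →L[ℂ] H} (v : OrthonormalBasis (Fin n) ℂ V.ker)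
    (T : H →L[ℂ] H) : Matrix (Fin n) (Fin n) ℂ :=
  Matrix.of fun k j => ⟪(v k : H), T (v j : H)⟫_ℂ

/-- Livšic's formula
`z [⟨(U - z)⁻¹ vⱼ, vₖ⟩] [⟨(U - z)⁻¹ U vⱼ, vₖ⟩]⁻¹` for the characteristic function. -/
def livsicFunction {n : ℕ} {V : H →L[ℂ] H} (v : OrthonormalBasis (Fin n) ℂ V.ker)
    (U : H →L[ℂ] H) (z : ℂ) : Matrix (Fin n) (Fin n) ℂ :=
  z • (compressionMatrix v (Ring.inverse (U - z • (1 : H →L[ℂ] H))) *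
    (compressionMatrix v (Ring.inverse (U - z • (1 : H →L[ℂ] H)) * U))⁻¹)

/-- `b` is, on the unit disk, the characteristic function `w_V` computed from some orthonormal
basis of `ker V` and some unitary extension of `V`. -/
def IsCharacteristicFunction {n : ℕ} (V : H →L[ℂ] H) (b : ℂ → Matrix (Fin n) (Fin n) ℂ) : Prop :=
  ∃ (v : OrthonormalBasis (Fin n) ℂ V.ker) (U : H →L[ℂ] H), IsUnitaryExtension V U ∧
    ∀ z : ℂ, ‖z‖ < 1 → b z = livsicFunction v U z

/-- `Γ` is an abstract model for `V`: it is anti-analytic on `ℂ ∖ 𝕋`, and `Γ(z)` is a linear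
bijection of `ℂⁿ` onto `((V - z) (ker V)ᗮ)ᗮ` for every `z` there. -/
structure IsAbstractModel {n : ℕ} (V : H →L[ℂ] H) (Γ : ℂ → Cn n →L[ℂ] H) : Prop where
  antianalytic : AnalyticOnNhd ℂ (fun z => Γ (conj z)) offCircle
  injective : ∀ z ∈ offCircle, Function.Injective (Γ z)
  range_eq : ∀ z ∈ offCircle, (Γ z).range =
    (Submodule.map (V - z • (1 : H →L[ℂ] H)).toLinearMap (V.ker)ᗮ)ᗮ

/-- The transform `f ↦ f̂`, `f̂(z) = Γ(z)* f` for `z ∈ ℂ ∖ 𝕋`. -/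
def modelTransform {n : ℕ} (Γ : ℂ → Cn n →L[ℂ] H) : H →L[ℂ] (offCircle → Cn n) :=
  ContinuousLinearMap.pi fun z => ContinuousLinearMap.adjoint (Γ z)

/-- The abstract model space `{f̂ : f ∈ H}`, with inner product `⟨f̂, ĝ⟩ = ⟨f, g⟩`, which makes
sense as soon as `f ↦ f̂` is injective. It is `H` itself, whose elements are read as functions
through `f ↦ f̂` (see the `RKHS` instance below). -/
def AbstractModelSpace {n : ℕ} (Γ : ℂ → Cn n →L[ℂ] H)
    (_h : Function.Injective (modelTransform Γ)) : Type _ := H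

variable {n : ℕ} {Γ : ℂ → Cn n →L[ℂ] H} {h : Function.Injective (modelTransform Γ)}

instance : NormedAddCommGroup (AbstractModelSpace Γ h) := inferInstanceAs (NormedAddCommGroup H)

instance : InnerProductSpace ℂ (AbstractModelSpace Γ h) :=
  inferInstanceAs (InnerProductSpace ℂ H)

instance : CompleteSpace (AbstractModelSpace Γ h) := inferInstanceAs (CompleteSpace H)

instance : RKHS ℂ (AbstractModelSpace Γ h) offCircle (Cn n) where
  coeCLM := (modelTransform Γ : H →L[ℂ] (offCircle → Cn n))
  coeCLM_injective := h

end Operators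

section Herglotz

variable {n : ℕ}

/-- `G_b = (I + b)(I - b)⁻¹` on the disk, extended to `|z| > 1` by `G(z) = -G(1 / z̄)*`. -/
def herglotzFunction (b : ℂ → Matrix (Fin n) (Fin n) ℂ) (z : ℂ) : Matrix (Fin n) (Fin n) ℂ :=
  if ‖z‖ < 1 then (1 + b z) * (1 - b z)⁻¹
  else -((1 + b (conj z)⁻¹) * (1 - b (conj z)⁻¹)⁻¹)ᴴ

/-- The Herglotz kernel `K_w(z) = (G_b(z) + G_b(w)*) / (1 - z w̄)`, as a matrix with rows indexed
by `z` and columns by `w`. When `z w̄ = 1` the numerator vanishes identically, and the value of the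
kernel is the removable-singularity value `-z G_b'(z)`, the limit of `K_w(ζ)` as `ζ → z`. -/
def herglotzKernel (b : ℂ → Matrix (Fin n) (Fin n) ℂ) :
    Matrix offCircle offCircle (Cn n →L[ℂ] Cn n) :=
  Matrix.of fun z w => Matrix.toEuclideanCLM (𝕜 := ℂ) <|
    if (z : ℂ) * conj (w : ℂ) = 1 then
      -((z : ℂ) • Matrix.of fun i j => deriv (fun ζ : ℂ => herglotzFunction b ζ i j) (z : ℂ))
    else
      (1 - (z : ℂ) * conj (w : ℂ))⁻¹ •
        (herglotzFunction b z + (herglotzFunction b w)ᴴ)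

/-- The Herglotz space `ℒ(b)`: the reproducing kernel Hilbert space of `ℂⁿ`-valued functions on
`ℂ ∖ 𝕋` whose kernel is the Herglotz kernel. -/
abbrev HerglotzSpace (b : ℂ → Matrix (Fin n) (Fin n) ℂ) [Fact (herglotzKernel b).PosSemidef] :
    Type :=
  RKHS.OfKernel (herglotzKernel b)

/-- `W` is an isometric multiplier of the function Hilbert space `A` onto the function Hilbert
space `B`: `W A = B`, and `‖W F‖ = ‖F‖` for all `F ∈ A`. -/
def IsIsometricMultiplierOnto (W : ℂ → Matrix (Fin n) (Fin n) ℂ) (A B : Type*)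
    [NormedAddCommGroup A] [InnerProductSpace ℂ A] [RKHS ℂ A offCircle (Cn n)]
    [NormedAddCommGroup B] [InnerProductSpace ℂ B] [RKHS ℂ B offCircle (Cn n)] : Prop :=
  (Set.range fun (F : A) (z : offCircle) => Matrix.toEuclideanCLM (𝕜 := ℂ) (W z) (F z)) =
      Set.range (fun (G : B) (z : offCircle) => G z) ∧
    ∀ (F : A) (G : B),
      (∀ z : offCircle, G z = Matrix.toEuclideanCLM (𝕜 := ℂ) (W z) (F z)) → ‖G‖ = ‖F‖

end Herglotz

end HerglotzModel

end

open HerglotzModel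

/-!
Let `U` be a unitary extension of `V`, let `J : ℂⁿ → H` be the isometry onto `ker V` given by an
orthonormal basis, and put `R(z) = (U - z)⁻¹` off the circle.

The theorem holds because one particular model, `Γ₁(z) = √2 R(z)* J` (`canonicalModel`), has the
Herglotz kernel as its reproducing kernel, and every other model is obtained from it by an
invertible matrix function. In detail:

* Livšic's formula is a compressed Cayley transform: `G_b(z) = J* R(z) (U + z) J` for every `z` off
  the circle (`toEuclideanCLM_herglotzFunction`). Inside the disk this is algebra, once
  `J* R(z) U J` is known to be invertible (`isUnit_compression`); outside it is the reflection
  `C(z) = -C(1 / z̄)*` of the Cayley transform `C(z) = R(z) (U + z)`.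
* The identity `C(z) + C(w)* = 2 (1 - z w̄) R(z) R(w)*` (`cayleyAt_add_star`) shows that the Herglotz
  kernel is `Γ₁(z)* Γ₁(w)`, also at the removable singularities `z w̄ = 1`
  (`herglotzKernel_eq`).
* The range condition on a model `Γ` says that `(U - z)* Γ(z)` maps into `ker V`. Hence
  `Γ(z) = R(z)* J D(z)*` with the analytic invertible matrix `D(z) = Γ(z)* (U - z) J`
  (`model_eq`), and `W = √2 D⁻¹` gives `Γ W* = Γ₁` (`model_comp_herglotzMultiplier`).
* The transform of a model is injective because the `f` with `J* R(z) f = 0` for all `z` form a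
  reducing subspace on which `V` is unitary (`unobservableSubspace_eq_bot`).
* A function Hilbert space is determined by its kernel (`exists_eq_of_kernel_eq`), so the model
  space of `Γ₁` is the Herglotz space, and multiplication by `W` carries the model space of `Γ`
  onto that of `Γ₁`.
-/

noncomputable section
namespace HerglotzModel
open scoped InnerProductSpace ComplexConjugate Matrix
open ContinuousLinearMap Filter Topology

/-! ### Function Hilbert spaces with the same kernel -/

section Kernel

variable {X E A B : Type*} [NormedAddCommGroup E] [InnerProductSpace ℂ E] [CompleteSpace E]
  [NormedAddCommGroup A] [InnerProductSpace ℂ A] [CompleteSpace A] [RKHS ℂ A X E]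
  [NormedAddCommGroup B] [InnerProductSpace ℂ B] [CompleteSpace B] [RKHS ℂ B X E]

variable (A B) in
/-- The pairs of corresponding finite combinations of kernel functions of two spaces. -/
def kernelPairs : Submodule ℂ (A × B) :=
  Submodule.span ℂ {p | ∃ (x : X) (v : E), p = (RKHS.kerFun A x v, RKHS.kerFun B x v)}

lemma inner_eq_inner_of_mem_kernelPairs (hAB : RKHS.kernel A = RKHS.kernel B) {p q : A × B}
    (hp : p ∈ kernelPairs A B) (hq : q ∈ kernelPairs A B) : ⟪p.1, q.1⟫_ℂ = ⟪p.2, q.2⟫_ℂ := by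
  induction hp using Submodule.span_induction with
  | zero => simp
  | add p p' _ _ h h' => simp [h, h']
  | smul c p _ h => simp [h]
  | mem p hp =>
    obtain ⟨x, v, rfl⟩ := hp
    induction hq using Submodule.span_induction with
    | zero => simp
    | add p p' _ _ h h' => simp only [Prod.fst_add, Prod.snd_add, inner_add_right, h, h']
    | smul c p _ h => simp only [Prod.smul_fst, Prod.smul_snd, inner_smul_right, h]
    | mem q hq =>
      obtain ⟨y, w, rfl⟩ := hq
      rw [← RKHS.kernel_inner, ← RKHS.kernel_inner, hAB]

lemma norm_eq_norm_of_mem_closure (hAB : RKHS.kernel A = RKHS.kernel B) {p : A × B}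
    (hp : p ∈ (kernelPairs A B).topologicalClosure) : ‖p.1‖ = ‖p.2‖ := by
  have hc : IsClosed {p : A × B | ‖p.1‖ = ‖p.2‖} := isClosed_eq (by fun_prop) (by fun_prop)
  refine closure_minimal (fun q hq => ?_) hc hp
  have := inner_eq_inner_of_mem_kernelPairs hAB hq hq
  rw [inner_self_eq_norm_sq_to_K, inner_self_eq_norm_sq_to_K] at this
  have h2 : ‖q.1‖ ^ 2 = ‖q.2‖ ^ 2 := by exact_mod_cast this
  exact (pow_left_inj₀ (norm_nonneg _) (norm_nonneg _) two_ne_zero).1 h2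

lemma apply_eq_apply_of_mem_closure (hAB : RKHS.kernel A = RKHS.kernel B) {p : A × B}
    (hp : p ∈ (kernelPairs A B).topologicalClosure) (x : X) : p.1 x = p.2 x := by
  have hc : IsClosed {p : A × B | p.1 x = p.2 x} :=
    isClosed_eq ((RKHS.continuous_eval x).comp continuous_fst)
      ((RKHS.continuous_eval x).comp continuous_snd)
  refine closure_minimal (fun q hq => ?_) hc hp
  refine ext_inner_left ℂ fun v => ?_
  have := inner_eq_inner_of_mem_kernelPairs hAB (Submodule.subset_span ⟨x, v, rfl⟩) hq
  simpa using this

/-- A function Hilbert space is determined, with its norm, by its kernel. The isometry is the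
closure of the correspondence between kernel functions: its first projection is isometric, so its
range is closed, and this range contains the kernel functions. -/
theorem exists_eq_of_kernel_eq (hAB : RKHS.kernel A = RKHS.kernel B) (F : A) :
    ∃ G : B, (∀ x, G x = F x) ∧ ‖G‖ = ‖F‖ := by
  let S := (kernelPairs A B).topologicalClosure
  let T : S →ₗᵢ[ℂ] A :=
    { toLinearMap := LinearMap.fst ℂ A B ∘ₗ S.subtype
      norm_map' := fun p => by
        change ‖p.1.1‖ = max ‖p.1.1‖ ‖p.1.2‖
        rw [← norm_eq_norm_of_mem_closure hAB p.2, max_self] }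
  have : CompleteSpace S := (kernelPairs A B).isClosed_topologicalClosure.completeSpace_coe
  have hcl : IsClosed (T.toLinearMap.range : Set A) := by
    rw [LinearMap.coe_range]
    exact T.isometry.isClosedEmbedding.isClosed_range
  have htop : T.toLinearMap.range = ⊤ := by
    rw [eq_top_iff, ← RKHS.kerFun_dense A]
    refine Submodule.topologicalClosure_minimal _ (Submodule.span_le.2 ?_) hcl
    rintro _ ⟨x, v, rfl⟩
    exact ⟨⟨(RKHS.kerFun A x v, RKHS.kerFun B x v),
      subset_closure (Submodule.subset_span ⟨x, v, rfl⟩)⟩, rfl⟩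
  obtain ⟨p, rfl⟩ : F ∈ T.toLinearMap.range := htop ▸ Submodule.mem_top
  exact ⟨p.1.2, fun x => (apply_eq_apply_of_mem_closure hAB p.2 x).symm,
    (norm_eq_norm_of_mem_closure hAB p.2).symm⟩

end Kernel

/-! ### Resolvents of a unitary operator -/

section Resolvent

variable {H : Type*} [NormedAddCommGroup H] [InnerProductSpace ℂ H] [CompleteSpace H]

lemma isOpen_offCircle : IsOpen offCircle :=
  isOpen_ne_fun continuous_norm continuous_const

lemma conj_mem_offCircle {z : ℂ} : conj z ∈ offCircle ↔ z ∈ offCircle := by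
  simp [offCircle]

/-- The resolvent `(U - z)⁻¹`. -/
def resolventAt (U : H →L[ℂ] H) (z : ℂ) : H →L[ℂ] H := Ring.inverse (U - z • 1)

variable {U : H →L[ℂ] H} {z w : ℂ}

lemma isUnit_sub_smul_one (hU : U ∈ unitary (H →L[ℂ] H)) (hz : z ∈ offCircle) :
    IsUnit (U - z • (1 : H →L[ℂ] H)) := by
  rcases subsingleton_or_nontrivial H with hH | hH
  · exact isUnit_of_subsingleton _
  · by_contra h
    refine hz (spectrum.norm_eq_one_of_unitary (𝕜 := ℂ) hU (z := z) fun hr => h ?_)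
    rw [spectrum.mem_resolventSet_iff, Algebra.algebraMap_eq_smul_one] at hr
    simpa using hr.neg

lemma sub_mul_resolventAt (hU : U ∈ unitary (H →L[ℂ] H)) (hz : z ∈ offCircle) :
    (U - z • 1) * resolventAt U z = 1 :=
  Ring.mul_inverse_cancel _ (isUnit_sub_smul_one hU hz)

lemma resolventAt_mul_sub (hU : U ∈ unitary (H →L[ℂ] H)) (hz : z ∈ offCircle) :
    resolventAt U z * (U - z • 1) = 1 :=
  Ring.inverse_mul_cancel _ (isUnit_sub_smul_one hU hz)

lemma sub_mul_star_resolventAt (hU : U ∈ unitary (H →L[ℂ] H)) (hz : z ∈ offCircle) :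
    (star U - conj z • 1) * star (resolventAt U z) = 1 := by
  simpa using congrArg star (resolventAt_mul_sub hU hz)

lemma star_resolventAt_mul_sub (hU : U ∈ unitary (H →L[ℂ] H)) (hz : z ∈ offCircle) :
    star (resolventAt U z) * (star U - conj z • 1) = 1 := by
  simpa using congrArg star (sub_mul_resolventAt hU hz)

lemma resolventAt_zero (hU : U ∈ unitary (H →L[ℂ] H)) : resolventAt U 0 = star U := by
  have h := resolventAt_mul_sub hU (z := 0) (by simp [offCircle])
  rw [zero_smul, sub_zero] at h
  rw [← mul_one (resolventAt U 0), ← (Unitary.mem_iff.1 hU).2, ← mul_assoc, h, one_mul]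

lemma differentiableAt_resolventAt (hU : U ∈ unitary (H →L[ℂ] H)) (hz : z ∈ offCircle) :
    DifferentiableAt ℂ (resolventAt U) z :=
  DifferentiableAt.inverse (h := fun z : ℂ => U - z • (1 : H →L[ℂ] H)) (by fun_prop)
    (isUnit_sub_smul_one hU hz)

/-- `(U - z)⁻¹ (U + z)`, the Cayley transform whose compression to `ker V` is `G_b(z)`. -/
def cayleyAt (U : H →L[ℂ] H) (z : ℂ) : H →L[ℂ] H := resolventAt U z * (U + z • 1)

/-- The operator form of the kernel identity. When `z w̄ = 1` it is the reflection
`C(z) = -C(1 / z̄)*`. -/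
lemma cayleyAt_add_star (hU : U ∈ unitary (H →L[ℂ] H)) (hz : z ∈ offCircle)
    (hw : w ∈ offCircle) :
    cayleyAt U z + star (cayleyAt U w) =
      (2 * (1 - z * conj w)) • (resolventAt U z * star (resolventAt U w)) := by
  have key : (U + z • 1) * (star U - conj w • 1) + (U - z • 1) * (star U + conj w • 1) =
      (2 * (1 - z * conj w)) • (1 : H →L[ℂ] H) := by
    have hUU := (Unitary.mem_iff.1 hU).2
    simp only [add_mul, sub_mul, mul_add, mul_sub, hUU, smul_mul_assoc, mul_smul_comm, one_mul,
      mul_one]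
    module
  calc cayleyAt U z + star (cayleyAt U w)
      = resolventAt U z * (U + z • 1) * ((star U - conj w • 1) * star (resolventAt U w)) +
        (resolventAt U z * (U - z • 1)) * ((star U + conj w • 1) * star (resolventAt U w)) := by
        rw [sub_mul_star_resolventAt hU hw, resolventAt_mul_sub hU hz]
        simp [cayleyAt]
    _ = resolventAt U z * ((U + z • 1) * (star U - conj w • 1) +
          (U - z • 1) * (star U + conj w • 1)) * star (resolventAt U w) := by noncomm_ring
    _ = _ := by rw [key]; simp

lemma tendsto_resolventAt_cobounded (U : H →L[ℂ] H) :
    Tendsto (resolventAt U) (Bornology.cobounded ℂ) (𝓝 0) := by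
  have h : resolventAt U = fun z => -resolvent U z := by
    ext1 z
    by_cases hu : IsUnit (U - z • (1 : H →L[ℂ] H))
    · have h1 : (U - z • 1) * resolventAt U z = 1 := Ring.mul_inverse_cancel _ hu
      have h2 : resolvent U z * (z • 1 - U) = 1 := by
        rw [resolvent, Algebra.algebraMap_eq_smul_one]
        exact Ring.inverse_mul_cancel _ (by simpa using hu.neg)
      calc resolventAt U z = resolvent U z * (z • 1 - U) * resolventAt U z := by rw [h2, one_mul]
        _ = -(resolvent U z * ((U - z • 1) * resolventAt U z)) := by noncomm_ring
        _ = _ := by rw [h1, mul_one]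
    · rw [resolvent, resolventAt, Algebra.algebraMap_eq_smul_one, Ring.inverse_non_unit _ hu,
        Ring.inverse_non_unit _ fun h => hu (by simpa using h.neg), neg_zero]
  rw [h]
  rcases subsingleton_or_nontrivial H with hH | hH
  · exact tendsto_const_nhds.congr fun z => Subsingleton.elim _ _
  · simpa using (spectrum.resolvent_tendsto_cobounded (𝕜 := ℂ) U).neg

end Resolvent

/-! ### Compressions to the kernel of `V` -/

section Compression

variable {H : Type*} [NormedAddCommGroup H] [InnerProductSpace ℂ H]
  {n : ℕ} {V U : H →L[ℂ] H} (v : OrthonormalBasis (Fin n) ℂ V.ker)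

/-- The isometry `ℂⁿ → H` onto `ker V` that sends the standard basis to `v`. -/
def kerIsometry : Cn n →L[ℂ] H :=
  V.ker.subtypeL ∘L (v.repr.symm.toContinuousLinearEquiv : Cn n →L[ℂ] V.ker)

lemma norm_kerIsometry (c : Cn n) : ‖kerIsometry v c‖ = ‖c‖ :=
  v.repr.symm.norm_map c

lemma kerIsometry_mem (c : Cn n) : kerIsometry v c ∈ V.ker := by
  simp only [kerIsometry, coe_comp, Function.comp_apply]
  exact Subtype.property _

lemma range_kerIsometry : (kerIsometry v).range = V.ker := by
  refine le_antisymm ?_ fun x hx => ⟨v.repr ⟨x, hx⟩, by simp [kerIsometry]⟩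
  rintro _ ⟨c, rfl⟩
  exact kerIsometry_mem v c

lemma kerIsometry_single (j : Fin n) : kerIsometry v (EuclideanSpace.single j 1) = v j := by
  simp [kerIsometry]

variable [CompleteSpace H]

/-- The compression `J* T J` of `T` to `ker V`, as an operator on `ℂⁿ`; here `J` is
`kerIsometry v`. -/
def compression (T : H →L[ℂ] H) : Cn n →L[ℂ] Cn n :=
  adjoint (kerIsometry v) ∘L T ∘L kerIsometry v

lemma adjoint_kerIsometry_comp_self : adjoint (kerIsometry v) ∘L kerIsometry v = 1 :=
  (norm_map_iff_adjoint_comp_self _).1 (norm_kerIsometry v)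

lemma kerIsometry_adjoint_apply {x : H} (hx : x ∈ V.ker) :
    kerIsometry v (adjoint (kerIsometry v) x) = x := by
  obtain ⟨c, rfl⟩ : x ∈ (kerIsometry v).range := (range_kerIsometry v).symm ▸ hx
  have := congrArg (fun T : Cn n →L[ℂ] Cn n => T c) (adjoint_kerIsometry_comp_self v)
  exact congrArg _ this

lemma adjoint_kerIsometry_eq_zero {x : H} :
    adjoint (kerIsometry v) x = 0 ↔ x ∈ (V.ker)ᗮ := by
  rw [← range_kerIsometry v, Submodule.mem_orthogonal]
  constructor
  · rintro h _ ⟨c, rfl⟩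
    change ⟪kerIsometry v c, x⟫_ℂ = 0
    rw [← adjoint_inner_right, h, inner_zero_right]
  · intro h
    refine ext_inner_left ℂ fun c => ?_
    rw [adjoint_inner_right, inner_zero_right]
    exact h _ ⟨c, rfl⟩

lemma toEuclideanCLM_single_apply (M : Matrix (Fin n) (Fin n) ℂ) (i j : Fin n) :
    (Matrix.toEuclideanCLM (𝕜 := ℂ) M (EuclideanSpace.single j 1)) i = M i j := by
  rw [Matrix.ofLp_toEuclideanCLM]
  simp

lemma toEuclideanCLM_ext {S : Cn n →L[ℂ] Cn n} {M : Matrix (Fin n) (Fin n) ℂ}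
    (h : ∀ i j, M i j = S (EuclideanSpace.single j 1) i) :
    Matrix.toEuclideanCLM (𝕜 := ℂ) M = S := by
  obtain ⟨N, rfl⟩ := (Matrix.toEuclideanCLM (𝕜 := ℂ) (n := Fin n)).surjective S
  refine congrArg _ (Matrix.ext fun i j => ?_)
  exact (h i j).trans (toEuclideanCLM_single_apply N i j)

lemma toEuclideanCLM_compressionMatrix (T : H →L[ℂ] H) :
    Matrix.toEuclideanCLM (𝕜 := ℂ) (compressionMatrix v T) = compression v T := by
  refine toEuclideanCLM_ext fun i j => ?_
  have : compression v T (EuclideanSpace.single j 1) i =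
      ⟪EuclideanSpace.single i (1 : ℂ), compression v T (EuclideanSpace.single j 1)⟫_ℂ := by
    simp [EuclideanSpace.inner_single_left]
  rw [this, compression, coe_comp, Function.comp_apply, adjoint_inner_right, coe_comp,
    Function.comp_apply, kerIsometry_single, kerIsometry_single]
  rfl

lemma compression_add (S T : H →L[ℂ] H) :
    compression v (S + T) = compression v S + compression v T := by
  simp [compression]

lemma compression_sub (S T : H →L[ℂ] H) :
    compression v (S - T) = compression v S - compression v T := by
  simp [compression]

lemma compression_smul (c : ℂ) (T : H →L[ℂ] H) :
    compression v (c • T) = c • compression v T := by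
  simp [compression]

lemma compression_one : compression v 1 = 1 :=
  adjoint_kerIsometry_comp_self v

lemma star_compression (T : H →L[ℂ] H) : star (compression v T) = compression v (star T) := by
  simp only [compression, star_eq_adjoint, adjoint_comp, adjoint_adjoint, comp_assoc]

lemma isUnit_of_injective {T : Cn n →L[ℂ] Cn n} (h : Function.Injective T) : IsUnit T := by
  rw [ContinuousLinearMap.isUnit_iff_bijective]
  exact ⟨h, LinearMap.injective_iff_surjective (f := T.toLinearMap).1 h⟩

/-- If `y = (U - z)⁻¹ U x` with `x ∈ ker V` is orthogonal to `ker V`, then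
`‖y‖² ≤ ‖y - x‖² = |z|² ‖y‖²`, because `y - x = z U* y`; so `y = 0`. -/
lemma isUnit_compression (hU : U ∈ unitary (H →L[ℂ] H)) {z : ℂ} (hz : ‖z‖ < 1) :
    IsUnit (compression v (resolventAt U z * U)) := by
  have hz' : z ∈ offCircle := hz.ne
  refine isUnit_of_injective ((injective_iff_map_eq_zero _).2 fun c hc => ?_)
  set x := kerIsometry v c with hx
  set y := resolventAt U z (U x) with hy
  have hxy : ⟪x, y⟫_ℂ = 0 := by
    have hc' : adjoint (kerIsometry v) y = 0 := hc
    rw [hx, ← adjoint_inner_right, hc', inner_zero_right]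
  have h1 : U y - z • y = U x := by
    have := congrArg (fun T : H →L[ℂ] H => T (U x)) (sub_mul_resolventAt hU hz')
    simpa using this
  have h2 : ‖y - x‖ = ‖z‖ * ‖y‖ := by
    rw [← norm_smul, ← norm_map_of_mem_unitary hU (y - x), map_sub, ← h1, sub_sub_cancel]
  have h3 : ‖y - x‖ ^ 2 = ‖y‖ ^ 2 + ‖x‖ ^ 2 := by
    have := @norm_sub_sq ℂ _ _ _ _ y x
    rw [← inner_conj_symm, hxy] at this
    simpa using this
  have h4 : ‖y‖ = 0 := by
    by_contra h
    have hpos : 0 < ‖y‖ := lt_of_le_of_ne (norm_nonneg _) (Ne.symm h)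
    have : ‖z‖ * ‖y‖ < ‖y‖ := by nlinarith
    nlinarith [sq_nonneg ‖x‖, mul_nonneg (norm_nonneg z) hpos.le]
  have h5 : ‖x‖ = 0 := by
    rw [h2, h4] at h3
    simpa using h3.symm
  rwa [hx, norm_kerIsometry, norm_eq_zero] at h5

/-- Inside the disk, `I - b = B⁻¹` and `I + b = (B + z A) B⁻¹` where `A` and `B` are the
compressions of `(U - z)⁻¹` and `(U - z)⁻¹ U`, so `G_b = B + z A`. -/
lemma toEuclideanCLM_cayley_livsic (hU : U ∈ unitary (H →L[ℂ] H)) {z : ℂ} (hz : ‖z‖ < 1) :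
    Matrix.toEuclideanCLM (𝕜 := ℂ)
      ((1 + livsicFunction v U z) * (1 - livsicFunction v U z)⁻¹) =
      compression v (cayleyAt U z) := by
  have hz' : z ∈ offCircle := hz.ne
  set A := compressionMatrix v (resolventAt U z)
  set B := compressionMatrix v (resolventAt U z * U)
  have hEA : Matrix.toEuclideanCLM (𝕜 := ℂ) A = _ := toEuclideanCLM_compressionMatrix v _
  have hEB : Matrix.toEuclideanCLM (𝕜 := ℂ) B = _ := toEuclideanCLM_compressionMatrix v _
  have hBu : IsUnit B := by
    rw [← isUnit_map_iff (Matrix.toEuclideanCLM (𝕜 := ℂ) (n := Fin n)), hEB]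
    exact isUnit_compression v hU hz
  have hBd : IsUnit B.det := (Matrix.isUnit_iff_isUnit_det _).1 hBu
  have hBA : B - z • A = 1 := by
    refine EquivLike.injective (Matrix.toEuclideanCLM (𝕜 := ℂ) (n := Fin n)) ?_
    rw [map_sub, map_smul, hEA, hEB, map_one, ← compression_smul, ← compression_sub,
      ← compression_one v, ← resolventAt_mul_sub hU hz', mul_sub]
    simp
  have hb : livsicFunction v U z = (z • A) * B⁻¹ := (smul_mul_assoc _ _ _).symm
  have h1 : 1 - livsicFunction v U z = B⁻¹ := by
    calc 1 - livsicFunction v U z = (B - z • A) * B⁻¹ := by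
          rw [hb, sub_mul, Matrix.mul_nonsing_inv _ hBd]
      _ = _ := by rw [hBA, one_mul]
  have h2 : 1 + livsicFunction v U z = (B + z • A) * B⁻¹ := by
    rw [hb, add_mul, Matrix.mul_nonsing_inv _ hBd]
  rw [h1, h2, mul_assoc, Matrix.mul_nonsing_inv _ (by simpa using hBd), mul_one, map_add,
    map_smul, hEA, hEB, ← compression_smul, ← compression_add]
  simp [cayleyAt, mul_add]

variable {v} in
lemma toEuclideanCLM_herglotzFunction (hU : U ∈ unitary (H →L[ℂ] H))
    {b : ℂ → Matrix (Fin n) (Fin n) ℂ} (hb : ∀ z : ℂ, ‖z‖ < 1 → b z = livsicFunction v U z)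
    {z : ℂ} (hz : z ∈ offCircle) :
    Matrix.toEuclideanCLM (𝕜 := ℂ) (herglotzFunction b z) = compression v (cayleyAt U z) := by
  rw [herglotzFunction]
  split_ifs with h
  · rw [hb z h, toEuclideanCLM_cayley_livsic v hU h]
  · have h1 : 1 < ‖z‖ := lt_of_le_of_ne (not_lt.1 h) (Ne.symm hz)
    have hw : ‖(conj z)⁻¹‖ < 1 := by
      rw [norm_inv, RCLike.norm_conj]
      exact inv_lt_one_of_one_lt₀ h1
    have hz0 : z ≠ 0 := by
      rintro rfl
      simp at h
    have hrefl := cayleyAt_add_star hU hz (w := (conj z)⁻¹) hw.ne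
    have h0 : 1 - z * conj ((conj z)⁻¹) = 0 := by simp [hz0]
    rw [h0, mul_zero, zero_smul] at hrefl
    rw [map_neg, ← Matrix.star_eq_conjTranspose, map_star, hb _ hw,
      toEuclideanCLM_cayley_livsic v hU hw, star_compression, ← neg_one_smul ℂ,
      ← compression_smul, neg_one_smul, ← eq_neg_of_add_eq_zero_left hrefl]

end Compression

/-! ### Complete non-unitarity -/

section NonUnitary

variable {H : Type*} [NormedAddCommGroup H] [InnerProductSpace ℂ H] [CompleteSpace H]
  {n : ℕ} {V U : H →L[ℂ] H}

/-- The vectors `f` such that `J* (U - z)⁻¹ f = 0` for all `z` off the circle. -/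
def unobservableSubspace (v : OrthonormalBasis (Fin n) ℂ V.ker) (U : H →L[ℂ] H) :
    Submodule ℂ H :=
  ⨅ z ∈ offCircle, (adjoint (kerIsometry v) ∘L resolventAt U z).ker

variable {v : OrthonormalBasis (Fin n) ℂ V.ker}

lemma mem_unobservableSubspace {f : H} : f ∈ unobservableSubspace v U ↔
    ∀ z ∈ offCircle, adjoint (kerIsometry v) (resolventAt U z f) = 0 := by
  simp [unobservableSubspace]

lemma isClosed_unobservableSubspace :
    IsClosed (unobservableSubspace v U : Set H) := by
  simp only [unobservableSubspace, Submodule.coe_iInf]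
  exact isClosed_iInter fun z => isClosed_iInter fun _ => ContinuousLinearMap.isClosed_ker _

lemma apply_resolventAt (hU : U ∈ unitary (H →L[ℂ] H)) {z : ℂ} (hz : z ∈ offCircle) (f : H) :
    U (resolventAt U z f) = f + z • resolventAt U z f := by
  have h : U (resolventAt U z f) - z • resolventAt U z f = f :=
    congrArg (fun T : H →L[ℂ] H => T f) (sub_mul_resolventAt hU hz)
  exact sub_eq_iff_eq_add.1 h

lemma resolventAt_apply (hU : U ∈ unitary (H →L[ℂ] H)) {z : ℂ} (hz : z ∈ offCircle) (f : H) :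
    resolventAt U z (U f) = f + z • resolventAt U z f := by
  have h : resolventAt U z (U f - z • f) = f :=
    congrArg (fun T : H →L[ℂ] H => T f) (resolventAt_mul_sub hU hz)
  rw [map_sub, map_smul] at h
  exact sub_eq_iff_eq_add.1 h

lemma self_apply_star (hU : U ∈ unitary (H →L[ℂ] H)) (f : H) : U (star U f) = f :=
  congrArg (fun T : H →L[ℂ] H => T f) (Unitary.mem_iff.1 hU).2

/-- In `U (U - z)⁻¹ f = f + z (U - z)⁻¹ f` the last term is killed by `J*`, and the left side tends
to `0` as `z → ∞`; so `J* f = 0`. -/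
lemma unobservableSubspace_le (hU : U ∈ unitary (H →L[ℂ] H)) :
    unobservableSubspace v U ≤ (V.ker)ᗮ := by
  intro f hf
  rw [mem_unobservableSubspace] at hf
  rw [← adjoint_kerIsometry_eq_zero v]
  have h1 : Tendsto (fun z => adjoint (kerIsometry v) (U (resolventAt U z f)))
      (Bornology.cobounded ℂ) (𝓝 0) := by
    have h : Continuous fun T : H →L[ℂ] H => adjoint (kerIsometry v) (U (T f)) := by fun_prop
    simpa [Function.comp_def] using (h.tendsto 0).comp (tendsto_resolventAt_cobounded U)
  refine tendsto_nhds_unique (tendsto_const_nhds.congr' ?_) h1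
  filter_upwards [eventually_cobounded_le_norm (E := ℂ) 2] with z hz
  have hz' : z ∈ offCircle := by
    intro h
    rw [h] at hz
    norm_num at hz
  rw [apply_resolventAt hU hz', map_add, map_smul, hf z hz', smul_zero, add_zero]

lemma apply_mem_unobservableSubspace (hU : U ∈ unitary (H →L[ℂ] H)) {f : H}
    (hf : f ∈ unobservableSubspace v U) : U f ∈ unobservableSubspace v U := by
  have h0 := (adjoint_kerIsometry_eq_zero v).2 (unobservableSubspace_le hU hf)
  rw [mem_unobservableSubspace] at hf ⊢
  intro z hz
  rw [resolventAt_apply hU hz, map_add, map_smul, hf z hz, h0, smul_zero, add_zero]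

/-- For `z ≠ 0` this follows from `z (U - z)⁻¹ U* = (U - z)⁻¹ - U⁻¹`; the case `z = 0` follows
by continuity. -/
lemma star_apply_mem_unobservableSubspace (hU : U ∈ unitary (H →L[ℂ] H)) {f : H}
    (hf : f ∈ unobservableSubspace v U) : star U f ∈ unobservableSubspace v U := by
  have hz0 : (0 : ℂ) ∈ offCircle := by simp [offCircle]
  rw [mem_unobservableSubspace] at hf ⊢
  have h0 := hf 0 hz0
  rw [resolventAt_zero hU] at h0
  have hne : ∀ z ∈ offCircle, z ≠ 0 →
      adjoint (kerIsometry v) (resolventAt U z (star U f)) = 0 := by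
    intro z hz hzne
    have h := resolventAt_apply hU hz (star U f)
    rw [self_apply_star hU] at h
    have h2 := congrArg (adjoint (kerIsometry v)) h
    rw [hf z hz, map_add, h0, zero_add, map_smul] at h2
    exact (smul_eq_zero.1 h2.symm).resolve_left hzne
  intro z hz
  rcases eq_or_ne z 0 with rfl | hzne
  · have hc : Tendsto (fun z => adjoint (kerIsometry v) (resolventAt U z (star U f))) (𝓝[≠] 0)
        (𝓝 (adjoint (kerIsometry v) (resolventAt U 0 (star U f)))) :=
      ((adjoint (kerIsometry v)).continuous.continuousAt.comp
        ((differentiableAt_resolventAt hU hz0).continuousAt.clm_apply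
          continuousAt_const)).tendsto.mono_left nhdsWithin_le_nhds
    refine tendsto_nhds_unique hc (tendsto_const_nhds.congr' ?_)
    filter_upwards [self_mem_nhdsWithin,
      mem_nhdsWithin_of_mem_nhds (isOpen_offCircle.mem_nhds hz0)] with z hz1 hz2
    exact (hne z hz2 hz1).symm
  · exact hne z hz hzne

/-- On the unobservable subspace `V` coincides with `U` and `V*` with `U*`, so it is a reducing
subspace on which `V` is unitary. -/
lemma unobservableSubspace_eq_bot (hV : IsCompletelyNonUnitary V) (hU : IsUnitaryExtension V U) :
    unobservableSubspace v U = ⊥ := by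
  obtain ⟨hU, hUV⟩ := hU
  have hle := unobservableSubspace_le (v := v) hU
  have hVU : ∀ x ∈ unobservableSubspace v U, V x = U x := fun x hx => (hUV x (hle hx)).symm
  refine hV _ isClosed_unobservableSubspace (fun x hx => ?_) (fun x hx => ?_) (fun x hx => ?_)
    fun y hy => ⟨star U y, star_apply_mem_unobservableSubspace hU hy, ?_⟩
  · exact hVU x hx ▸ apply_mem_unobservableSubspace hU hx
  · have hs := star_apply_mem_unobservableSubspace hU hx
    convert! hs using 1
    refine ext_inner_right ℂ fun g => ?_
    have : CompleteSpace V.ker := V.isClosed_ker.completeSpace_coe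
    obtain ⟨g₁, hg₁, g₂, hg₂, rfl⟩ := V.ker.exists_add_mem_mem_orthogonal g
    have hg₁' : V g₁ = 0 := hg₁
    rw [adjoint_inner_left, map_add, hg₁', zero_add, inner_add_right,
      Submodule.inner_left_of_mem_orthogonal hg₁ (hle hs), zero_add, star_eq_adjoint,
      adjoint_inner_left, hUV g₂ hg₂]
  · rw [hVU x hx, norm_map_of_mem_unitary hU]
  · rw [hVU _ (star_apply_mem_unobservableSubspace hU hy), self_apply_star hU]

end NonUnitary

/-! ### The canonical model and its kernel -/

section Model

variable {H : Type*} [NormedAddCommGroup H] [InnerProductSpace ℂ H] [CompleteSpace H]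
  {n : ℕ} {V U : H →L[ℂ] H}

/-- The abstract model `√2 (U* - z̄)⁻¹ J`, whose reproducing kernel is the Herglotz kernel. -/
def canonicalModel (v : OrthonormalBasis (Fin n) ℂ V.ker) (U : H →L[ℂ] H) (z : ℂ) :
    Cn n →L[ℂ] H :=
  (√2 : ℂ) • (star (resolventAt U z) ∘L kerIsometry v)

variable {v : OrthonormalBasis (Fin n) ℂ V.ker}

lemma adjoint_canonicalModel (z : ℂ) : adjoint (canonicalModel v U z) =
    (√2 : ℂ) • (adjoint (kerIsometry v) ∘L resolventAt U z) := by
  rw [canonicalModel, map_smulₛₗ, adjoint_comp, star_eq_adjoint, adjoint_adjoint,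
    Complex.conj_ofReal]

lemma adjoint_canonicalModel_comp (z w : ℂ) :
    adjoint (canonicalModel v U z) ∘L canonicalModel v U w =
      (2 : ℂ) • compression v (resolventAt U z * star (resolventAt U w)) := by
  have h : (√2 : ℂ) * (√2 : ℂ) = 2 := by
    rw [← Complex.ofReal_mul, Real.mul_self_sqrt zero_le_two]
    norm_num
  rw [adjoint_canonicalModel, canonicalModel, smul_comp, comp_smul, smul_smul, h]
  rfl

lemma analyticOnNhd_canonicalModel (hU : U ∈ unitary (H →L[ℂ] H)) :
    AnalyticOnNhd ℂ (fun z => canonicalModel v U (conj z)) offCircle := by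
  refine DifferentiableOn.analyticOnNhd (fun z hz => ?_) isOpen_offCircle
  have h : (fun z => canonicalModel v U (conj z)) =
      fun z => (√2 : ℂ) • (resolventAt (star U) z ∘L kerIsometry v) := by
    ext1 z
    rw [canonicalModel, resolventAt, resolventAt, ← Ring.inverse_star]
    simp
  rw [h]
  have h2 := differentiableAt_resolventAt (Unitary.star_mem hU) hz
  exact ((h2.clm_comp (differentiableAt_const (kerIsometry v))).const_smul
    (√2 : ℂ)).differentiableWithinAt

/-- Off the set `z w̄ = 1` this is `cayleyAt_add_star`. If `z w̄ = 1`, the numerator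
`G_b(ζ) + G_b(w)*` vanishes at `ζ = z`, and the kernel identity nearby computes the difference
quotients of `G_b` at `z`. -/
theorem herglotzKernel_eq (hU : U ∈ unitary (H →L[ℂ] H))
    {b : ℂ → Matrix (Fin n) (Fin n) ℂ} (hb : ∀ z : ℂ, ‖z‖ < 1 → b z = livsicFunction v U z)
    (z w : offCircle) :
    herglotzKernel b z w = adjoint (canonicalModel v U z) ∘L canonicalModel v U w := by
  have hsum : ∀ ζ ∈ offCircle, Matrix.toEuclideanCLM (𝕜 := ℂ)
      (herglotzFunction b ζ + (herglotzFunction b w)ᴴ) =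
      (1 - ζ * conj (w : ℂ)) • (adjoint (canonicalModel v U ζ) ∘L canonicalModel v U w) := by
    intro ζ hζ
    rw [map_add, ← Matrix.star_eq_conjTranspose, map_star, toEuclideanCLM_herglotzFunction hU hb hζ,
      toEuclideanCLM_herglotzFunction hU hb w.2, star_compression, ← compression_add,
      cayleyAt_add_star hU hζ w.2, adjoint_canonicalModel_comp, compression_smul, smul_smul,
      mul_comm]
  rw [herglotzKernel, Matrix.of_apply]
  split_ifs with h
  · refine toEuclideanCLM_ext fun i j => ?_
    set e : Cn n := EuclideanSpace.single j 1
    set k : ℂ → ℂ := fun ζ =>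
      (adjoint (canonicalModel v U ζ) (canonicalModel v U w e)) i with hk
    have hentry : ∀ ζ ∈ offCircle, herglotzFunction b ζ i j + (herglotzFunction b w)ᴴ i j =
        (1 - ζ * conj (w : ℂ)) * k ζ := by
      intro ζ hζ
      have := congrArg (fun T : Cn n →L[ℂ] Cn n => T e i) (hsum ζ hζ)
      rw [toEuclideanCLM_single_apply] at this
      simpa using this
    have hkc : ContinuousAt k z := by
      have h1 : Continuous fun T : H →L[ℂ] H =>
          ((√2 : ℂ) • adjoint (kerIsometry v) (T (canonicalModel v U w e))) i := by fun_prop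
      simp only [hk, adjoint_canonicalModel]
      exact h1.continuousAt.comp (differentiableAt_resolventAt hU z.2).continuousAt
    have hderiv : HasDerivAt (fun ζ => herglotzFunction b ζ i j) (-conj (w : ℂ) * k z) z := by
      rw [hasDerivAt_iff_tendsto_slope]
      refine ((hkc.tendsto.mono_left nhdsWithin_le_nhds).const_mul (-conj (w : ℂ))).congr' ?_
      filter_upwards [self_mem_nhdsWithin,
        mem_nhdsWithin_of_mem_nhds (isOpen_offCircle.mem_nhds z.2)] with ζ h1 h2
      have hne : ζ - z ≠ 0 := sub_ne_zero.2 h1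
      have hz := hentry z z.2
      rw [h, sub_self, zero_mul] at hz
      have hd : herglotzFunction b ζ i j - herglotzFunction b z i j =
          (ζ - z) * (-conj (w : ℂ) * k ζ) := by
        linear_combination hentry ζ h2 - hz - k ζ * h
      rw [slope_def_field, hd, mul_div_cancel_left₀ _ hne]
    change -((z : ℂ) * deriv (fun ζ => herglotzFunction b ζ i j) z) = k z
    rw [hderiv.deriv]
    linear_combination k z * h
  · rw [map_smul, hsum z z.2, smul_smul, inv_mul_cancel₀ (sub_ne_zero.2 (Ne.symm h)), one_smul]

end Model

/-! ### Comparison of an abstract model with the canonical one -/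

lemma differentiableAt_det {n : ℕ} {M : ℂ → Matrix (Fin n) (Fin n) ℂ} {z : ℂ}
    (h : ∀ i j, DifferentiableAt ℂ (fun ζ => M ζ i j) z) :
    DifferentiableAt ℂ (fun ζ => (M ζ).det) z := by
  simp only [Matrix.det_apply]
  fun_prop

lemma differentiableAt_inv_apply {n : ℕ} {M : ℂ → Matrix (Fin n) (Fin n) ℂ} {z : ℂ}
    (h : ∀ i j, DifferentiableAt ℂ (fun ζ => M ζ i j) z) (hz : IsUnit (M z)) (i j : Fin n) :
    DifferentiableAt ℂ (fun ζ => (M ζ)⁻¹ i j) z := by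
  simp only [Matrix.inv_def, Matrix.smul_apply, Ring.inverse_eq_inv', smul_eq_mul,
    Matrix.adjugate_apply]
  refine ((differentiableAt_det h).inv
    ((Matrix.isUnit_iff_isUnit_det _).1 hz).ne_zero).mul (differentiableAt_det fun k l => ?_)
  by_cases hk : k = j
  · simp [Matrix.updateRow_apply, hk]
  · simpa [Matrix.updateRow_apply, hk] using h k l

section Comparison

variable {H : Type*} [NormedAddCommGroup H] [InnerProductSpace ℂ H]
  {n : ℕ} {V U : H →L[ℂ] H} {v : OrthonormalBasis (Fin n) ℂ V.ker} {Γ : ℂ → Cn n →L[ℂ] H}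

lemma isAbstractModel_comp {W : ℂ → Matrix (Fin n) (Fin n) ℂ} (hΓ : IsAbstractModel V Γ)
    (hW : ∀ z ∈ offCircle, IsUnit (W z))
    (han : AnalyticOnNhd ℂ
      (fun z => Γ (conj z) ∘L Matrix.toEuclideanCLM (𝕜 := ℂ) (W (conj z))ᴴ) offCircle) :
    IsAbstractModel V fun z => Γ z ∘L Matrix.toEuclideanCLM (𝕜 := ℂ) (W z)ᴴ := by
  have hbij : ∀ z ∈ offCircle,
      Function.Bijective (Matrix.toEuclideanCLM (𝕜 := ℂ) (W z)ᴴ) := fun z hz => by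
    rw [← ContinuousLinearMap.isUnit_iff_bijective, isUnit_map_iff]
    exact (hW z hz).star
  refine ⟨han, fun z hz => (hΓ.injective z hz).comp (hbij z hz).1, fun z hz => ?_⟩
  rw [← hΓ.range_eq z hz]
  exact LinearMap.range_comp_of_range_eq_top _ (LinearMap.range_eq_top.2 (hbij z hz).2)

variable [CompleteSpace H]

/-- The matrix of `Γ(z)* (U - z) J`. Its adjoint carries the coordinates of a vector with respect
to `Γ(z)` to those with respect to `(U* - z̄)⁻¹ J`. -/
def transitionMatrix (Γ : ℂ → Cn n →L[ℂ] H) (v : OrthonormalBasis (Fin n) ℂ V.ker)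
    (U : H →L[ℂ] H) (z : ℂ) : Matrix (Fin n) (Fin n) ℂ :=
  Matrix.of fun i j => ⟪Γ z (EuclideanSpace.single i 1), (U - z • (1 : H →L[ℂ] H)) (v j : H)⟫_ℂ

lemma toEuclideanCLM_transitionMatrix (z : ℂ) :
    Matrix.toEuclideanCLM (𝕜 := ℂ) (transitionMatrix Γ v U z) =
      adjoint (Γ z) ∘L (U - z • 1) ∘L kerIsometry v := by
  refine toEuclideanCLM_ext fun i j => ?_
  rw [transitionMatrix, Matrix.of_apply, ← adjoint_inner_right, EuclideanSpace.inner_single_left,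
    ← kerIsometry_single]
  simp

lemma star_sub_apply_mem_ker (hU : IsUnitaryExtension V U) (hΓ : IsAbstractModel V Γ) {z : ℂ}
    (hz : z ∈ offCircle) (c : Cn n) : star (U - z • 1) (Γ z c) ∈ V.ker := by
  have : CompleteSpace V.ker := V.isClosed_ker.completeSpace_coe
  have hc : Γ z c ∈ (Γ z).range := ⟨c, rfl⟩
  rw [hΓ.range_eq z hz, Submodule.mem_orthogonal] at hc
  rw [← V.ker.orthogonal_orthogonal, Submodule.mem_orthogonal]
  intro x hx
  rw [star_eq_adjoint, adjoint_inner_right]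
  refine hc _ ⟨x, hx, ?_⟩
  change V x - z • x = U x - z • x
  rw [hU.2 x hx]

/-- `(U - z)* Γ(z)` maps into `ker V`, so it is `J J* (U - z)* Γ(z)`. -/
lemma model_eq (hU : IsUnitaryExtension V U) (hΓ : IsAbstractModel V Γ) {z : ℂ}
    (hz : z ∈ offCircle) : Γ z = star (resolventAt U z) ∘L kerIsometry v ∘L
      star (Matrix.toEuclideanCLM (𝕜 := ℂ) (transitionMatrix Γ v U z)) := by
  ext1 c
  have h1 : star (resolventAt U z) (star (U - z • 1) (Γ z c)) = Γ z c := by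
    have h := congrArg (fun T : H →L[ℂ] H => T (Γ z c)) (star_resolventAt_mul_sub hU.1 hz)
    simpa using h
  rw [← h1, ← kerIsometry_adjoint_apply v (star_sub_apply_mem_ker hU hΓ hz c),
    toEuclideanCLM_transitionMatrix]
  simp only [star_eq_adjoint, adjoint_comp, adjoint_adjoint]
  rfl

lemma isUnit_transitionMatrix (hU : IsUnitaryExtension V U) (hΓ : IsAbstractModel V Γ) {z : ℂ}
    (hz : z ∈ offCircle) : IsUnit (transitionMatrix Γ v U z) := by
  -- by `model_eq`, `Γ(z)` factors through the adjoint of this matrix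
  rw [← isUnit_map_iff (Matrix.toEuclideanCLM (𝕜 := ℂ) (n := Fin n)), ← isUnit_star]
  refine isUnit_of_injective (Function.Injective.of_comp
    (f := star (resolventAt U z) ∘L kerIsometry v) ?_)
  have h := hΓ.injective z hz
  rw [model_eq (v := v) hU hΓ hz] at h
  exact h

/-- The multiplier `√2 (Γ(z)* (U - z) J)⁻¹` from the model space of `Γ` onto the Herglotz
space. -/
def herglotzMultiplier (Γ : ℂ → Cn n →L[ℂ] H) (v : OrthonormalBasis (Fin n) ℂ V.ker)
    (U : H →L[ℂ] H) (z : ℂ) : Matrix (Fin n) (Fin n) ℂ :=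
  (√2 : ℂ) • (transitionMatrix Γ v U z)⁻¹

lemma isUnit_herglotzMultiplier (hU : IsUnitaryExtension V U) (hΓ : IsAbstractModel V Γ) {z : ℂ}
    (hz : z ∈ offCircle) : IsUnit (herglotzMultiplier Γ v U z) := by
  have h2 : IsUnit (√2 : ℂ) := by simp
  obtain ⟨c, hc⟩ := h2
  rw [herglotzMultiplier, ← hc]
  exact (Matrix.isUnit_nonsing_inv_iff.2 (isUnit_transitionMatrix hU hΓ hz)).smul c

lemma model_comp_herglotzMultiplier (hU : IsUnitaryExtension V U) (hΓ : IsAbstractModel V Γ)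
    {z : ℂ} (hz : z ∈ offCircle) :
    Γ z ∘L Matrix.toEuclideanCLM (𝕜 := ℂ) (herglotzMultiplier Γ v U z)ᴴ =
      canonicalModel v U z := by
  have hinv : (transitionMatrix Γ v U z)ᴴ * (herglotzMultiplier Γ v U z)ᴴ =
      (√2 : ℂ) • (1 : Matrix (Fin n) (Fin n) ℂ) := by
    rw [herglotzMultiplier, ← Matrix.conjTranspose_mul, smul_mul_assoc,
      Matrix.nonsing_inv_mul _ ((Matrix.isUnit_iff_isUnit_det _).1
        (isUnit_transitionMatrix hU hΓ hz))]
    simp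
  have hcomp : star (Matrix.toEuclideanCLM (𝕜 := ℂ) (transitionMatrix Γ v U z)) ∘L
      Matrix.toEuclideanCLM (𝕜 := ℂ) (herglotzMultiplier Γ v U z)ᴴ =
      (√2 : ℂ) • (1 : Cn n →L[ℂ] Cn n) := by
    rw [← map_star, Matrix.star_eq_conjTranspose, ← mul_def, ← map_mul, hinv, map_smul, map_one]
  conv_lhs => rw [model_eq (v := v) hU hΓ hz]
  rw [comp_assoc, comp_assoc, hcomp, canonicalModel, comp_smul, comp_smul]
  rfl

lemma analyticOnNhd_herglotzMultiplier (hU : IsUnitaryExtension V U) (hΓ : IsAbstractModel V Γ)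
    (i j : Fin n) :
    AnalyticOnNhd ℂ (fun z => herglotzMultiplier Γ v U z i j) offCircle := by
  refine DifferentiableOn.analyticOnNhd (fun z hz => ?_) isOpen_offCircle
  have hentry : ∀ i j, DifferentiableAt ℂ (fun ζ => transitionMatrix Γ v U ζ i j) z := by
    intro i j
    -- the entry is `conj (g (conj ζ))`, where `g` is analytic because `Γ` is anti-analytic
    set g : ℂ → ℂ := fun u => ⟪U (v j : H), Γ (conj u) (EuclideanSpace.single i 1)⟫_ℂ -
      u * ⟪(v j : H), Γ (conj u) (EuclideanSpace.single i 1)⟫_ℂ with hg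
    have hgd : DifferentiableAt ℂ g (conj z) := by
      have hΓd := (hΓ.antianalytic _ (conj_mem_offCircle.2 hz)).differentiableAt
      have hin : ∀ x : H, DifferentiableAt ℂ
          (fun u => ⟪x, Γ (conj u) (EuclideanSpace.single i 1)⟫_ℂ) (conj z) := fun x =>
        (innerSL ℂ x).differentiableAt.comp _ (hΓd.clm_apply (differentiableAt_const _))
      exact (hin _).sub (differentiableAt_id.mul (hin _))
    have h := hgd.conj_conj
    rw [Complex.conj_conj] at h
    convert! h using 2 with ζ
    simp [hg, transitionMatrix]
  simp only [herglotzMultiplier, Matrix.smul_apply]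
  exact ((differentiableAt_inv_apply hentry (isUnit_transitionMatrix hU hΓ hz) i j).const_smul
    (√2 : ℂ)).differentiableWithinAt

lemma modelTransform_injective (hV : IsCompletelyNonUnitary V) (hU : IsUnitaryExtension V U)
    (v : OrthonormalBasis (Fin n) ℂ V.ker) (hΓ : IsAbstractModel V Γ) :
    Function.Injective (modelTransform Γ) := by
  refine (injective_iff_map_eq_zero _).2 fun f hf => ?_
  have hmem : f ∈ unobservableSubspace v U := by
    rw [mem_unobservableSubspace]
    intro z hz
    have h : adjoint (canonicalModel v U z) f = 0 := by
      rw [← model_comp_herglotzMultiplier hU hΓ hz, adjoint_comp]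
      change adjoint _ (modelTransform Γ f ⟨z, hz⟩) = 0
      rw [hf, Pi.zero_apply, map_zero]
    rw [adjoint_canonicalModel] at h
    have h2 : (√2 : ℂ) ≠ 0 := by simp
    exact (smul_eq_zero (M := Cn n).1 h).resolve_left h2
  rwa [unobservableSubspace_eq_bot hV hU, Submodule.mem_bot] at hmem

lemma kernel_abstractModelSpace (h : Function.Injective (modelTransform Γ)) (z w : offCircle) :
    RKHS.kernel (AbstractModelSpace Γ h) z w = adjoint (Γ z) ∘L Γ w := by
  have hker : ∀ x : offCircle, RKHS.kerFun (AbstractModelSpace Γ h) x = Γ x := fun x =>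
    adjoint_adjoint (Γ x)
  rw [RKHS.kernel_apply, hker, hker]
  rfl

/-- A vector of `H` as an element of the abstract model space. -/
def toModelSpace (h : Function.Injective (modelTransform Γ)) (f : H) : AbstractModelSpace Γ h := f

lemma toModelSpace_surjective (h : Function.Injective (modelTransform Γ)) :
    Function.Surjective (toModelSpace h) := fun f => ⟨f, rfl⟩

lemma toModelSpace_apply (h : Function.Injective (modelTransform Γ)) (f : H) (z : offCircle) :
    toModelSpace h f z = modelTransform Γ f z := rfl

lemma norm_toModelSpace (h : Function.Injective (modelTransform Γ)) (f : H) :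
    ‖toModelSpace h f‖ = ‖f‖ := rfl

/-- The correspondence between the model spaces of `Γ` and of `Γ W*` is multiplication by `W`,
since `(Γ(z) W(z)*)* f = W(z) Γ(z)* f`. -/
lemma modelTransform_comp_apply {W : ℂ → Matrix (Fin n) (Fin n) ℂ} {Γ' : ℂ → Cn n →L[ℂ] H}
    (hΓ' : ∀ z, Γ' z = Γ z ∘L Matrix.toEuclideanCLM (𝕜 := ℂ) (W z)ᴴ)
    (f : H) (z : offCircle) :
    modelTransform Γ' f z = Matrix.toEuclideanCLM (𝕜 := ℂ) (W z) (modelTransform Γ f z) := by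
  change adjoint (Γ' z) f = Matrix.toEuclideanCLM (𝕜 := ℂ) (W z) (adjoint (Γ z) f)
  rw [hΓ', adjoint_comp, ← star_eq_adjoint (Matrix.toEuclideanCLM (𝕜 := ℂ) (W z)ᴴ), ← map_star,
    Matrix.star_eq_conjTranspose, Matrix.conjTranspose_conjTranspose]
  rfl

end Comparison

/-! ### Isometric multipliers between model spaces and other function spaces -/

section Multiplier

variable {n : ℕ} {A B : Type*}
  [NormedAddCommGroup A] [InnerProductSpace ℂ A] [RKHS ℂ A offCircle (Cn n)]
  [NormedAddCommGroup B] [InnerProductSpace ℂ B] [RKHS ℂ B offCircle (Cn n)]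

lemma isIsometricMultiplierOnto_of_exists {W : ℂ → Matrix (Fin n) (Fin n) ℂ}
    (hto : ∀ F : A, ∃ G : B, (∀ z, G z = Matrix.toEuclideanCLM (𝕜 := ℂ) (W z) (F z)) ∧ ‖G‖ = ‖F‖)
    (hfrom : ∀ G : B, ∃ F : A, ∀ z, G z = Matrix.toEuclideanCLM (𝕜 := ℂ) (W z) (F z)) :
    IsIsometricMultiplierOnto W A B := by
  refine ⟨Set.Subset.antisymm ?_ ?_, fun F G hFG => ?_⟩
  · rintro _ ⟨F, rfl⟩
    obtain ⟨G, hG, -⟩ := hto F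
    exact ⟨G, funext hG⟩
  · rintro _ ⟨G, rfl⟩
    obtain ⟨F, hF⟩ := hfrom G
    exact ⟨F, funext fun z => (hF z).symm⟩
  · obtain ⟨G', hG', hn⟩ := hto F
    rw [RKHS.ext fun z => (hFG z).trans (hG' z).symm, hn]

variable [CompleteSpace A] [CompleteSpace B]

lemma isIsometricMultiplierOnto_one (hAB : RKHS.kernel A = RKHS.kernel B) :
    IsIsometricMultiplierOnto (fun _ => (1 : Matrix (Fin n) (Fin n) ℂ)) A B := by
  refine isIsometricMultiplierOnto_of_exists (fun F => ?_) fun G => ?_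
  · simpa using exists_eq_of_kernel_eq hAB F
  · obtain ⟨F, hF, -⟩ := exists_eq_of_kernel_eq hAB.symm G
    exact ⟨F, fun z => by simp [hF z]⟩

variable {H : Type*} [NormedAddCommGroup H] [InnerProductSpace ℂ H] [CompleteSpace H]

lemma isIsometricMultiplierOnto_of_comp {Γ Γ' : ℂ → Cn n →L[ℂ] H}
    {W : ℂ → Matrix (Fin n) (Fin n) ℂ}
    (hΓ' : ∀ z, Γ' z = Γ z ∘L Matrix.toEuclideanCLM (𝕜 := ℂ) (W z)ᴴ)
    (h : Function.Injective (modelTransform Γ)) (h' : Function.Injective (modelTransform Γ'))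
    (hB : RKHS.kernel (AbstractModelSpace Γ' h') = RKHS.kernel B) :
    IsIsometricMultiplierOnto W (AbstractModelSpace Γ h) B := by
  refine isIsometricMultiplierOnto_of_exists (fun F => ?_) fun G => ?_
  · obtain ⟨f, rfl⟩ := toModelSpace_surjective h F
    obtain ⟨G, hG, hn⟩ := exists_eq_of_kernel_eq hB (toModelSpace h' f)
    refine ⟨G, fun z => ?_, ?_⟩
    · rw [hG, toModelSpace_apply, toModelSpace_apply, modelTransform_comp_apply hΓ']
    · rw [hn, norm_toModelSpace, norm_toModelSpace]
  · obtain ⟨F, hF, -⟩ := exists_eq_of_kernel_eq hB.symm G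
    obtain ⟨f, rfl⟩ := toModelSpace_surjective h' F
    refine ⟨toModelSpace h f, fun z => ?_⟩
    rw [← hF, toModelSpace_apply, toModelSpace_apply, modelTransform_comp_apply hΓ']

end Multiplier

end HerglotzModel
end

open HerglotzModel
theorem mainTheorem3 {H : Type*} [NormedAddCommGroup H] [InnerProductSpace ℂ H] [CompleteSpace H]
    [TopologicalSpace.SeparableSpace H] (n : ℕ) (V : H →L[ℂ] H) (hV : IsClassV n V)
    (b : ℂ → Matrix (Fin n) (Fin n) ℂ) (hb : IsCharacteristicFunction V b)
    (Γ : ℂ → Cn n →L[ℂ] H) (hΓ : IsAbstractModel V Γ) :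
    ∃ (hinj : Function.Injective (modelTransform Γ)) (_ : Fact (herglotzKernel b).PosSemidef)
      (W : ℂ → Matrix (Fin n) (Fin n) ℂ),
      (∀ i j, AnalyticOnNhd ℂ (fun z => W z i j) offCircle) ∧
      IsIsometricMultiplierOnto W (AbstractModelSpace Γ hinj) (HerglotzSpace b) ∧
      -- `Γ W*` is again a model for `V`, and its model space is the Herglotz space
      IsAbstractModel V (fun z => Γ z ∘L Matrix.toEuclideanCLM (𝕜 := ℂ) (W z).conjTranspose) ∧
      ∃ hinj' : Function.Injective
          (modelTransform fun z => Γ z ∘L Matrix.toEuclideanCLM (𝕜 := ℂ) (W z).conjTranspose),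
        IsIsometricMultiplierOnto (fun _ => (1 : Matrix (Fin n) (Fin n) ℂ))
          (AbstractModelSpace
            (fun z => Γ z ∘L Matrix.toEuclideanCLM (𝕜 := ℂ) (W z).conjTranspose) hinj')
          (HerglotzSpace b) := by
  obtain ⟨v, U, hU, hb⟩ := hb
  set W := herglotzMultiplier Γ v U
  set Γ' : ℂ → Cn n →L[ℂ] H := fun z => Γ z ∘L Matrix.toEuclideanCLM (𝕜 := ℂ) (W z).conjTranspose
  have hcan : ∀ z ∈ offCircle, Γ' z = canonicalModel v U z := fun z hz =>
    model_comp_herglotzMultiplier hU hΓ hz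
  have hΓ' : IsAbstractModel V Γ' :=
    isAbstractModel_comp hΓ (fun z hz => isUnit_herglotzMultiplier hU hΓ hz)
      ((analyticOnNhd_canonicalModel hU.1).congr isOpen_offCircle fun z hz =>
        (hcan _ (conj_mem_offCircle.2 hz)).symm)
  have hinj := modelTransform_injective hV.completelyNonUnitary hU v hΓ
  have hinj' := modelTransform_injective hV.completelyNonUnitary hU v hΓ'
  have hK : RKHS.kernel (AbstractModelSpace Γ' hinj') = herglotzKernel b := by
    ext1 z w
    rw [kernel_abstractModelSpace, herglotzKernel_eq hU.1 hb, hcan z z.2, hcan w w.2]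
  have hpos : Fact (herglotzKernel b).PosSemidef :=
    ⟨hK ▸ RKHS.posSemidef_kernel (AbstractModelSpace Γ' hinj')⟩
  have hKK : RKHS.kernel (AbstractModelSpace Γ' hinj') = RKHS.kernel (HerglotzSpace b) :=
    hK.trans RKHS.OfKernel.kernel_ofKernel.symm
  exact ⟨hinj, hpos, W, analyticOnNhd_herglotzMultiplier hU hΓ,
    isIsometricMultiplierOnto_of_comp (fun _ => rfl) hinj hinj' hKK, hΓ', hinj',
    isIsometricMultiplierOnto_one hKK⟩
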